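/- For $X\in M_n(\mathbb C)$ let $|X|'=(XX^*)^{1/2}$ be the positive semidefinite factor of the left polar decomposition $X=|X|'U$, $U$ unitary. For $A\in M_n(\mathbb C)$ let $|\lambda_1(A)|\ge\cdots\ge|\lambda_n(A)|$ be the moduli of the eigenvalues of $A$ counted with algebraic multiplicity, and put $D=\operatorname{diag}(|\lambda_1(A)|,\dots,|\lambda_n(A)|)$. The hyperbolic element $H$ of $A$ is the matrix that acts as multiplication by $|\mu|$ on the generalized eigenspace of $A$ for each eigenvalue $\mu$; equivalently, if $A=PJP^{-1}$ with $J$ a Jordan canonical form of $A$, then $H=P\operatorname{diag}(|J_{11}|,\dots,|J_{nn}|)P^{-1}$. In particular $H=MDM^{-1}$ for some $M\in \mathrm{GL}_n(\mathbb C)$. Corollary. Let $A\in M_n(\mathbb C)$ and $B\in\mathrm{GL}_n(\mathbb C)$. There is a matrix $X\in M_n(\mathbb C)$, depending only on $A$ and $B$, such that $$\lim_{m\to\infty}\bigl(|BA^mC|'\bigr)^{1/m}=X\qquad\text{for every } C\in\mathrm{GL}_n(\mathbb C),$$ and such that, for every $M\in\mathrm{GL}_n(\mathbb C)$ with $H=MDM^{-1}$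 and every factorization $BM=QR$ with $Q$ unitary and $R$ upper triangular, $$X=QDQ^*.$$ In particular the limit is independent of $C$ and of the choice of $M$. -/

import Mathlib

open scoped MatrixOrder ComplexOrder Matrix Topology

/-- The moduli `|λ₁(A)| ≥ ⋯ ≥ |λₙ(A)|` of the eigenvalues of `A`, counted with algebraic
multiplicity, as a non-increasing list. -/
noncomputable def eigenvalueModuliList {n : ℕ} (A : Matrix (Fin n) (Fin n) ℂ) : List ℝ :=
  (A.charpoly.roots.map (fun z : ℂ => ‖z‖)).sort (· ≥ ·)

theorem length_eigenvalueModuliList {n : ℕ} (A : Matrix (Fin n) (Fin n) ℂ) :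
    (eigenvalueModuliList A).length = n := by
  rw [eigenvalueModuliList, Multiset.length_sort, Multiset.card_map,
    ← (IsAlgClosed.splits A.charpoly).natDegree_eq_card_roots, Matrix.charpoly_natDegree_eq_dim,
    Fintype.card_fin]

/-- `|λ_i(A)|`: the `i`-th largest eigenvalue modulus of `A`, counted with multiplicity. -/
noncomputable def eigenvalueModulus {n : ℕ} (A : Matrix (Fin n) (Fin n) ℂ) (i : Fin n) : ℝ :=
  (eigenvalueModuliList A).get (i.cast (length_eigenvalueModuliList A).symm)

/-- `D = diag(|λ₁(A)|, …, |λₙ(A)|)`. -/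
noncomputable def moduliDiagonal {n : ℕ} (A : Matrix (Fin n) (Fin n) ℂ) :
    Matrix (Fin n) (Fin n) ℂ :=
  Matrix.diagonal fun i => (eigenvalueModulus A i : ℂ)

/-- The generalized eigenspace of `A` for `μ` (zero if `μ` is not an eigenvalue). -/
noncomputable def genEigenspace {n : ℕ} (A : Matrix (Fin n) (Fin n) ℂ) (μ : ℂ) :
    Submodule ℂ (Fin n → ℂ) :=
  Module.End.maxGenEigenspace (Matrix.toLin' A) μ

theorem isCompl_genEigenspace {n : ℕ} (A : Matrix (Fin n) (Fin n) ℂ) (μ : ℂ) :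
    IsCompl (genEigenspace A μ) (⨆ ν, ⨆ (_ : ν ≠ μ), genEigenspace A ν) := by
  refine ⟨Module.End.independent_maxGenEigenspace (Matrix.toLin' A) μ, ?_⟩
  rw [codisjoint_iff, eq_top_iff, ← Module.End.iSup_maxGenEigenspace_eq_top (Matrix.toLin' A)]
  refine iSup_le fun ν => ?_
  by_cases h : ν = μ
  · subst h
    exact le_sup_left
  · exact le_sup_of_le_right (le_iSup₂_of_le ν h le_rfl)

/-- The projection of `ℂⁿ` onto the generalized eigenspace of `A` for `μ` along the sum of all
other generalized eigenspaces. -/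
noncomputable def genEigenProjection {n : ℕ} (A : Matrix (Fin n) (Fin n) ℂ) (μ : ℂ) :
    (Fin n → ℂ) →ₗ[ℂ] (Fin n → ℂ) :=
  Submodule.projection _ _ (isCompl_genEigenspace A μ)

/-- The hyperbolic element of `A`: the matrix acting as multiplication by `|μ|` on the generalized
eigenspace of `A` for each eigenvalue `μ`. The theorem `hyperbolicElement_eq_of_jordan` below shows
that it is given by the usual formula in terms of a Jordan form of `A`. -/
noncomputable def hyperbolicElement {n : ℕ} (A : Matrix (Fin n) (Fin n) ℂ) :
    Matrix (Fin n) (Fin n) ℂ :=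
  LinearMap.toMatrix' (∑ μ ∈ A.charpoly.roots.toFinset, (‖μ‖ : ℂ) • genEigenProjection A μ)

theorem hyperbolicElement_mulVec {n : ℕ} (A : Matrix (Fin n) (Fin n) ℂ) (μ : ℂ) (v : Fin n → ℂ)
    (hv : v ∈ genEigenspace A μ) : hyperbolicElement A *ᵥ v = (‖μ‖ : ℂ) • v := by
  have hother : ∀ ν, ν ≠ μ → genEigenProjection A ν v = 0 := by
    intro ν hν
    refine (Submodule.projection_apply_eq_zero_iff (isCompl_genEigenspace A ν)).2 ?_
    exact (le_iSup₂_of_le (f := fun κ (_ : κ ≠ ν) => genEigenspace A κ) μ hν.symm le_rfl) hv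
  have hself : genEigenProjection A μ v = v :=
    Submodule.projection_apply_of_mem_left (isCompl_genEigenspace A μ) hv
  rw [hyperbolicElement, LinearMap.toMatrix'_mulVec, LinearMap.sum_apply]
  by_cases hμ : μ ∈ A.charpoly.roots.toFinset
  · rw [Finset.sum_eq_single_of_mem μ hμ]
    · rw [LinearMap.smul_apply, hself]
    · intro ν _ hν
      rw [LinearMap.smul_apply, hother ν hν, smul_zero]
  · have hv0 : v = 0 := by
      by_contra hne
      apply hμ
      have hbot : Module.End.maxGenEigenspace (Matrix.toLin' A) μ ≠ ⊥ := by
        intro hb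
        apply hne
        have : v ∈ Module.End.maxGenEigenspace (Matrix.toLin' A) μ := hv
        rwa [hb, Submodule.mem_bot] at this
      have hev : Module.End.HasEigenvalue (Matrix.toLin' A) μ := by
        rw [Module.End.HasEigenvalue, Module.End.HasUnifEigenvalue]
        intro h1
        apply hbot
        rw [Module.End.maxGenEigenspace, Module.End.genEigenspace_top]
        refine (iSup_eq_bot.2 fun k => ?_)
        by_contra hk
        exact (Module.End.hasEigenvalue_of_hasGenEigenvalue (k := k) hk) h1
      rw [Multiset.mem_toFinset, Polynomial.mem_roots A.charpoly_monic.ne_zero,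
        ← Matrix.charpoly_toLin']
      exact (Module.End.hasEigenvalue_iff_isRoot_charpoly _ _).1 hev
    subst hv0
    simp

/-- `J` is a Jordan matrix, that is, a direct sum of Jordan blocks: nonzero entries occur only on
the diagonal and the first superdiagonal, the superdiagonal entries are `0` or `1`, and an entry
`1` joins equal diagonal entries. -/
def IsJordanMatrix {n : ℕ} (J : Matrix (Fin n) (Fin n) ℂ) : Prop :=
  ∀ i j : Fin n, i ≠ j →
    J i j = 0 ∨ (J i j = 1 ∧ (j : ℕ) = i + 1 ∧ J i i = J j j)

/-- If `A = M J M⁻¹` with `J` a Jordan matrix, then the hyperbolic element of `A` is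
`M diag(|J₁₁|, …, |Jₙₙ|) M⁻¹`. -/
theorem hyperbolicElement_eq_of_jordan {n : ℕ} (A J : Matrix (Fin n) (Fin n) ℂ)
    (M : Matrix.GeneralLinearGroup (Fin n) ℂ) (hJ : IsJordanMatrix J)
    (hA : A = M.val * J * (M⁻¹).val) :
    hyperbolicElement A = M.val * Matrix.diagonal (fun i => (‖J i i‖ : ℂ)) * (M⁻¹).val := by
  have hAM : A * M.val = M.val * J := by
    rw [hA, mul_assoc, M.inv_mul, mul_one]
  have hsum : ∀ k, A *ᵥ (M.val *ᵥ Pi.single k 1) =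
      ∑ i, J i k • (M.val *ᵥ Pi.single i 1) := by
    intro k
    have h1 : J *ᵥ Pi.single k 1 = ∑ i, J i k • (Pi.single i 1 : Fin n → ℂ) := by
      rw [Matrix.mulVec_single_one]
      exact pi_eq_sum_univ' (J.col k)
    rw [Matrix.mulVec_mulVec, hAM, ← Matrix.mulVec_mulVec, h1, Matrix.mulVec_sum]
    exact Finset.sum_congr rfl fun i _ => Matrix.mulVec_smul _ _ _
  have hcol : ∀ (k : ℕ) (hk : k < n),
      M.val *ᵥ Pi.single ⟨k, hk⟩ 1 ∈ genEigenspace A (J ⟨k, hk⟩ ⟨k, hk⟩) := by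
    intro k
    induction k using Nat.strong_induction_on with
    | _ k ih =>
      intro hk
      have hmem : (Matrix.toLin' A - J ⟨k, hk⟩ ⟨k, hk⟩ • (1 : Module.End ℂ (Fin n → ℂ)))
          (M.val *ᵥ Pi.single ⟨k, hk⟩ 1) ∈ genEigenspace A (J ⟨k, hk⟩ ⟨k, hk⟩) := by
        rw [LinearMap.sub_apply, LinearMap.smul_apply, Module.End.one_apply, Matrix.toLin'_apply,
          hsum, ← Finset.sum_erase_add _ _ (Finset.mem_univ (⟨k, hk⟩ : Fin n)), add_sub_cancel_right]
        refine Submodule.sum_mem _ fun i hi => ?_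
        rcases hJ i ⟨k, hk⟩ (Finset.ne_of_mem_erase hi) with h0 | ⟨h1, h2, h3⟩
        · rw [h0, zero_smul]
          exact Submodule.zero_mem _
        · refine Submodule.smul_mem _ _ ?_
          rw [← h3]
          have h2' : k = (i : ℕ) + 1 := h2
          exact ih i (by omega) i.2
      rw [genEigenspace, Module.End.mem_maxGenEigenspace] at hmem ⊢
      obtain ⟨p, hp⟩ := hmem
      exact ⟨p + 1, by rw [pow_succ, Module.End.mul_apply]; exact hp⟩
  have hHM : hyperbolicElement A * M.val =
      M.val * Matrix.diagonal (fun i => (‖J i i‖ : ℂ)) := by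
    refine Matrix.ext_of_mulVec_single fun k => ?_
    rw [← Matrix.mulVec_mulVec, ← Matrix.mulVec_mulVec,
      hyperbolicElement_mulVec A _ _ (hcol k k.2), Matrix.diagonal_mulVec_single, mul_one,
      ← Matrix.mulVec_smul]
    congr 1
    rw [← Pi.single_smul, smul_eq_mul, mul_one]
  rw [← hHM, mul_assoc, M.mul_inv, mul_one]

/-- The positive semidefinite factor `|X|' = (X X^*)^{1/2}` of the left polar decomposition
`X = |X|' U`. -/
noncomputable def leftAbs {n : ℕ} (X : Matrix (Fin n) (Fin n) ℂ) : Matrix (Fin n) (Fin n) ℂ :=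
  CFC.sqrt (X * Xᴴ)

/-! For `m ≥ n`, `m ≠ 0`, one has `A^m = H^m N^m`, where `N` is invertible with all eigenvalues of
modulus one; by Gelfand's formula the powers of `N` and `N⁻¹` grow subexponentially
(`pow_eq_hyperbolicElement_pow_mul`, `isSubexponential_norm_unimodularPart_pow`). With `H = M D M⁻¹`
and `B M = Q R`, the triangular factor passes through `D^m`: `R D^m = D^m S_m` with `S_m` and its
inverse bounded, because `D` is non-increasing (`exists_mul_diagonal_pow_eq`). Hence `B A^m C = E^m
y_m` with `E = Q D Q*` and `y_m = Q S_m M⁻¹ N^m C`, where `y_m` and `y_m⁻¹` are subexponential.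

For every `r > 1` and large `m` this gives `(r⁻¹E)^(2m) ≤ |E^m y_m|'^2 ≤ (rE)^(2m)`. Operator
monotonicity of `t ↦ t^(1/(2m))` turns it into `r⁻¹E ≤ (|E^m y_m|')^(1/m) ≤ rE`, and `r → 1` gives
the limit (`tendsto_abs_rpow_one_div`). The sequence does not involve `M`, `Q` or `R`, so uniqueness
of limits makes `Q D Q*` independent of them. -/

open Filter

/-! ### Subexponential growth -/

/-- `f` grows at most subexponentially: it is eventually below `r ^ m` for every `r > 1`. -/
def IsSubexponential (f : ℕ → ℝ) : Prop :=
  ∀ r : ℝ, 1 < r → ∀ᶠ m in atTop, f m ≤ r ^ m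

theorem IsSubexponential.mono {f g : ℕ → ℝ} (hf : IsSubexponential f)
    (h : ∀ᶠ m in atTop, g m ≤ f m) : IsSubexponential g := fun r hr => by
  filter_upwards [hf r hr, h] with m h1 h2 using h2.trans h1

theorem isSubexponential_const (c : ℝ) : IsSubexponential fun _ => c := fun _ hr =>
  (tendsto_pow_atTop_atTop_of_one_lt hr).eventually_ge_atTop c

theorem IsSubexponential.mul {f g : ℕ → ℝ} (hf : IsSubexponential f) (hg : IsSubexponential g)
    (hg0 : ∀ m, 0 ≤ g m) : IsSubexponential fun m => f m * g m := fun r hr => by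
  have hs : 1 < √r := by rw [Real.lt_sqrt zero_le_one]; simpa using hr
  filter_upwards [hf _ hs, hg _ hs] with m h1 h2
  calc f m * g m ≤ √r ^ m * √r ^ m := mul_le_mul h1 h2 (hg0 m) (by positivity)
    _ = r ^ m := by rw [← mul_pow, Real.mul_self_sqrt (by linarith)]

theorem isSubexponential_of_tendsto {f : ℕ → ℝ} {c : ℝ} (hf : Tendsto f atTop (𝓝 c)) :
    IsSubexponential f :=
  (isSubexponential_const (c + 1)).mono
    ((hf.eventually_lt_const (lt_add_one c)).mono fun _ h => h.le)

/-- Gelfand's formula: powers of an element whose spectrum lies in the closed unit disc grow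
subexponentially. -/
theorem isSubexponential_norm_pow {𝒜 : Type*} [NormedRing 𝒜] [NormedAlgebra ℂ 𝒜] [CompleteSpace 𝒜]
    (a : 𝒜) (ha : ∀ z ∈ spectrum ℂ a, ‖z‖ ≤ 1) : IsSubexponential fun m => ‖a ^ m‖ := fun r hr => by
  have hrad : spectralRadius ℂ a < ENNReal.ofReal r := by
    refine lt_of_le_of_lt (iSup₂_le fun z hz => ?_) (b := 1) (by simpa using hr)
    exact_mod_cast ha z hz
  have hlim := spectrum.pow_norm_pow_one_div_tendsto_nhds_spectralRadius a
  filter_upwards [hlim.eventually_lt_const hrad, eventually_gt_atTop 0] with m hm hm0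
  rw [ENNReal.ofReal_lt_ofReal_iff (by linarith)] at hm
  calc ‖a ^ m‖ = (‖a ^ m‖ ^ (1 / m : ℝ)) ^ m := by
        rw [one_div, Real.rpow_inv_natCast_pow (norm_nonneg _) hm0.ne']
    _ ≤ r ^ m := pow_le_pow_left₀ (by positivity) hm.le m

/-! ### Operator-monotone squeeze in a C⋆-algebra -/

section CStar

variable {𝒜 : Type*} [CStarAlgebra 𝒜] [PartialOrder 𝒜] [StarOrderedRing 𝒜]

/-- Conjugate `y y* ≤ ‖y‖² ≤ c²` by `a`. -/
theorem mul_star_conjugate_le_smul (a y : 𝒜) {c : ℝ} (hy : ‖y‖ ≤ c) :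
    a * y * star (a * y) ≤ c ^ 2 • (a * star a) := by
  have h1 : y * star y ≤ algebraMap ℝ 𝒜 (c ^ 2) :=
    CStarAlgebra.mul_star_le_algebraMap_norm_sq.trans
      (algebraMap_mono 𝒜 (pow_le_pow_left₀ (norm_nonneg _) hy 2))
  have h2 := star_right_conjugate_le_conjugate h1 a
  calc a * y * star (a * y) = a * (y * star y) * star a := by rw [star_mul]; noncomm_ring
    _ ≤ _ := h2
    _ = c ^ 2 • (a * star a) := by
        rw [Algebra.algebraMap_eq_smul_one, mul_smul_comm, smul_mul_assoc, mul_one]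

theorem pow_rpow_inv_natCast {a : 𝒜} (ha : 0 ≤ a) {k : ℕ} (hk : k ≠ 0) :
    (a ^ k) ^ (1 / (k : ℝ)) = a := by
  rw [← CFC.rpow_natCast a k, CFC.rpow_rpow_of_exponent_nonneg _ _ _ (by positivity)
    (by positivity), mul_one_div_cancel (by positivity), CFC.rpow_one a]

theorem sqrt_rpow_one_div {p : 𝒜} (hp : 0 ≤ p) {m : ℕ} (hm : m ≠ 0) :
    (CFC.sqrt p) ^ (1 / (m : ℝ)) = p ^ (1 / ((2 * m : ℕ) : ℝ)) := by
  have h : CFC.sqrt p = p ^ (1 / 2 : ℝ) := CFC.sqrt_eq_rpow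
  rw [h, CFC.rpow_rpow_of_exponent_nonneg _ _ _ (by positivity) (by positivity)]
  congr 1
  push_cast
  field_simp

/-- Roots of the absolute values of `e ^ m * y m` converge to `e ≥ 0` when `y m` and `(y m)⁻¹` grow
subexponentially. -/
theorem tendsto_abs_rpow_one_div {e : 𝒜} (he : 0 ≤ e) (y z : ℕ → 𝒜) (hyz : ∀ m, y m * z m = 1)
    (hy : IsSubexponential fun m => ‖y m‖) (hz : IsSubexponential fun m => ‖z m‖) :
    Tendsto (fun m : ℕ => (CFC.sqrt (e ^ m * y m * star (e ^ m * y m))) ^ (1 / (m : ℝ)))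
      atTop (𝓝 e) := by
  have hsa : star e = e := (IsSelfAdjoint.of_nonneg he).star_eq
  have key : ∀ r : ℝ, 1 < r → ∀ᶠ m : ℕ in atTop,
      ‖(CFC.sqrt (e ^ m * y m * star (e ^ m * y m))) ^ (1 / (m : ℝ)) - e‖ ≤
        (r - r⁻¹) * ‖e‖ + (1 - r⁻¹) * ‖e‖ := by
    intro r hr
    have hr0 : 0 < r := by linarith
    have hri : r⁻¹ < 1 := inv_lt_one_of_one_lt₀ hr
    filter_upwards [hy r hr, hz r hr, eventually_gt_atTop 0] with m h1 h2 hm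
    set p := e ^ m * y m * star (e ^ m * y m) with hp
    have hp0 : 0 ≤ p := mul_star_self_nonneg _
    have hee : e ^ m * star (e ^ m) = e ^ (2 * m) := by rw [star_pow, hsa, ← pow_add, two_mul]
    have hup : p ≤ (r • e) ^ (2 * m) := by
      refine (mul_star_conjugate_le_smul (e ^ m) (y m) h1).trans_eq ?_
      rw [hee, smul_pow, ← pow_mul, mul_comm m 2]
    -- Multiplying `e ^ m * y m` by `z m` recovers `e ^ m`, so the upper estimate for `z m` is a
    -- lower estimate for `p`.
    have hlow : (r⁻¹ • e) ^ (2 * m) ≤ p := by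
      have h3 := mul_star_conjugate_le_smul (e ^ m * y m) (z m) h2
      rw [mul_assoc (e ^ m) (y m) (z m), hyz, mul_one, hee, ← hp] at h3
      have h4 := smul_le_smul_of_nonneg_left h3 (inv_nonneg.2 (sq_nonneg (r ^ m)))
      rw [smul_smul, inv_mul_cancel₀ (by positivity), one_smul] at h4
      rw [smul_pow, inv_pow, mul_comm 2 m, pow_mul r m 2, mul_comm m 2]
      exact h4
    have hexp : (1 / ((2 * m : ℕ) : ℝ)) ∈ Set.Icc (0 : ℝ) 1 := by
      refine ⟨by positivity, ?_⟩
      rw [div_le_one (by positivity)]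
      exact_mod_cast (by omega : 1 ≤ 2 * m)
    -- Löwner–Heinz: powers with exponent in `[0, 1]` are operator monotone.
    have hx1 := CFC.rpow_le_rpow hexp hup
    have hx2 := CFC.rpow_le_rpow hexp hlow
    rw [pow_rpow_inv_natCast (smul_nonneg hr0.le he) (by omega)] at hx1
    rw [pow_rpow_inv_natCast (smul_nonneg (inv_nonneg.2 hr0.le) he) (by omega)] at hx2
    rw [sqrt_rpow_one_div hp0 hm.ne']
    set x := p ^ (1 / ((2 * m : ℕ) : ℝ))
    have h5 : ‖x - r⁻¹ • e‖ ≤ (r - r⁻¹) * ‖e‖ := by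
      refine (CStarAlgebra.norm_le_norm_of_nonneg_of_le (sub_nonneg.2 hx2)
        (sub_le_sub_right hx1 _)).trans_eq ?_
      rw [← sub_smul, norm_smul, Real.norm_of_nonneg (by linarith)]
    have h6 : ‖r⁻¹ • e - e‖ = (1 - r⁻¹) * ‖e‖ := by
      rw [norm_sub_rev, show e - r⁻¹ • e = (1 - r⁻¹) • e by rw [sub_smul, one_smul], norm_smul,
        Real.norm_of_nonneg (by linarith)]
    calc ‖x - e‖ = ‖(x - r⁻¹ • e) + (r⁻¹ • e - e)‖ := by rw [sub_add_sub_cancel]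
      _ ≤ _ := (norm_add_le _ _).trans (add_le_add h5 h6.le)
  rw [tendsto_iff_norm_sub_tendsto_zero, Metric.tendsto_nhds]
  intro ε hε
  have hcont : Tendsto (fun r : ℝ => (r - r⁻¹) * ‖e‖ + (1 - r⁻¹) * ‖e‖) (𝓝[>] 1) (𝓝 0) := by
    have : ContinuousAt (fun r : ℝ => (r - r⁻¹) * ‖e‖ + (1 - r⁻¹) * ‖e‖) 1 := by
      fun_prop (disch := norm_num)
    have h := this.tendsto
    norm_num at h
    exact h.mono_left nhdsWithin_le_nhds
  obtain ⟨r, hr, hr1⟩ := ((hcont.eventually_lt_const hε).and self_mem_nhdsWithin).exists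
  filter_upwards [key r hr1] with m hm
  rw [dist_zero_right, norm_norm]
  exact hm.trans_lt hr

end CStar

/-! ### QR factorization and triangular matrices -/

namespace Matrix

open scoped Norms.L2Operator

theorem exists_unitary_mul_isUpperTriangular {n : ℕ} (G : Matrix (Fin n) (Fin n) ℂ) :
    ∃ Q R : Matrix (Fin n) (Fin n) ℂ,
      Q ∈ unitaryGroup (Fin n) ℂ ∧ R.IsUpperTriangular ∧ G = Q * R := by
  let e := EuclideanSpace.basisFun (Fin n) ℂ
  let f : Fin n → EuclideanSpace ℂ (Fin n) := fun j => WithLp.toLp 2 fun i => G i j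
  have hcard : Module.finrank ℂ (EuclideanSpace ℂ (Fin n)) = Fintype.card (Fin n) := by simp
  let b := InnerProductSpace.gramSchmidtOrthonormalBasis hcard f
  refine ⟨e.toBasis.toMatrix b.toBasis, b.toBasis.toMatrix f, ?_,
    InnerProductSpace.gramSchmidtOrthonormalBasis_inv_isUpperTriangular hcard f, ?_⟩
  · rw [OrthonormalBasis.coe_toBasis]
    exact e.toMatrix_orthonormalBasis_mem_unitary b
  · rw [Module.Basis.toMatrix_mul_toMatrix]
    ext i j
    simp [Module.Basis.toMatrix_apply, e, f]

/-- The inverse is a fixed scalar times the adjugate, which is continuous. -/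
theorem tendsto_inv_of_det_eq {ι : Type*} {l : Filter ι} {n : ℕ}
    {S : ι → Matrix (Fin n) (Fin n) ℂ} {S₀ : Matrix (Fin n) (Fin n) ℂ} {c : ℂ}
    (hS : Tendsto S l (𝓝 S₀)) (hdet : ∀ i, (S i).det = c) :
    Tendsto (fun i => (S i)⁻¹) l (𝓝 (Ring.inverse c • S₀.adjugate)) := by
  simp_rw [inv_def, hdet]
  exact (((continuous_id.matrix_adjugate).tendsto S₀).comp hS).const_smul _

/-- Conjugating an invertible upper triangular matrix by the powers of a diagonal matrix with
non-increasing entries keeps it and its inverse bounded. -/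
theorem exists_mul_diagonal_pow_eq {n : ℕ} {d : Fin n → ℝ} (hd : Antitone d) (hd0 : ∀ i, 0 ≤ d i)
    {R : Matrix (Fin n) (Fin n) ℂ} (hR : R.IsUpperTriangular) (hdet : IsUnit R.det) :
    ∃ S T : ℕ → Matrix (Fin n) (Fin n) ℂ, (∀ m, S m * T m = 1) ∧
      (∀ m, R * diagonal (fun i => (d i : ℂ)) ^ m = diagonal (fun i => (d i : ℂ)) ^ m * S m) ∧
      IsSubexponential (fun m => ‖S m‖) ∧ IsSubexponential (fun m => ‖T m‖) := by
  -- If `d i = 0` then `d j = 0` for `j ≥ i`, so any ratio would do; the value `1` keeps the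
  -- diagonal of `S m` equal to that of `R`, hence the determinant constant.
  let ρ : Fin n → Fin n → ℝ := fun i j => if d i = 0 then 1 else d j / d i
  let S : ℕ → Matrix (Fin n) (Fin n) ℂ := fun m => of fun i j => R i j * (ρ i j : ℂ) ^ m
  have hρ : ∀ i j, d i * ρ i j = d j ∨ j < i := by
    intro i j
    by_cases hji : j < i
    · exact Or.inr hji
    · left
      by_cases hi : d i = 0
      · have := hd (not_lt.1 hji)
        simp only [ρ, hi, zero_mul]
        exact le_antisymm (hd0 j) (this.trans_eq hi)
      · simp only [ρ, hi, if_false]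
        field_simp
  have hρ1 : ∀ i, ρ i i = 1 := fun i => by
    by_cases hi : d i = 0 <;> simp [ρ, hi]
  have hSdet : ∀ m, (S m).det = R.det := by
    intro m
    have hSt : (S m).IsUpperTriangular := fun i j hij => by simp [S, hR hij]
    rw [det_of_isUpperTriangular hSt, det_of_isUpperTriangular hR]
    exact Finset.prod_congr rfl fun i _ => by simp [S, hρ1]
  have hlim : ∃ S₀, Tendsto S atTop (𝓝 S₀) := by
    have hent : ∀ i j, ∃ c, Tendsto (fun m => S m i j) atTop (𝓝 c) := by
      intro i j
      rcases lt_or_ge j i with hji | hij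
      · exact ⟨0, by simp [S, hR hji]⟩
      · have h0 : 0 ≤ ρ i j := by
          simp only [ρ]
          split_ifs
          exacts [zero_le_one, div_nonneg (hd0 j) (hd0 i)]
        have h1 : ρ i j ≤ 1 := by
          simp only [ρ]
          split_ifs
          exacts [le_rfl, div_le_one_of_le₀ (hd hij) (hd0 i)]
        have hpow : ∃ c : ℝ, Tendsto (fun m : ℕ => ρ i j ^ m) atTop (𝓝 c) := by
          rcases h1.eq_or_lt with h | h
          · exact ⟨1, by simp [h]⟩
          · exact ⟨0, tendsto_pow_atTop_nhds_zero_of_lt_one h0 h⟩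
        obtain ⟨c, hc⟩ := hpow
        refine ⟨R i j * c, Tendsto.const_mul _ ?_⟩
        have := (Complex.continuous_ofReal.tendsto c).comp hc
        simpa [Function.comp_def] using this
    choose c hc using hent
    exact ⟨of c, tendsto_pi_nhds.2 fun i => tendsto_pi_nhds.2 fun j => hc i j⟩
  obtain ⟨S₀, hS₀⟩ := hlim
  refine ⟨S, fun m => (S m)⁻¹, fun m => mul_nonsing_inv _ (by rwa [hSdet]), fun m => ?_,
    isSubexponential_of_tendsto hS₀.norm,
    isSubexponential_of_tendsto (tendsto_inv_of_det_eq hS₀ hSdet).norm⟩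
  ext i j
  rw [diagonal_pow, mul_diagonal, diagonal_mul]
  rcases hρ i j with h | h
  · simp only [S, of_apply, Pi.pow_apply, ← h]
    push_cast
    ring
  · simp [S, hR h]

end Matrix

/-- Lifts the sorting of the moduli to an ordering of the eigenvalues themselves. -/
theorem List.exists_perm_map_eq {α β : Type*} {f : α → β} {l : List α} {l' : List β}
    (h : (l.map f).Perm l') : ∃ k : List α, l.Perm k ∧ k.map f = l' := by
  have h1 : List.Forall₂ (fun b a => b = f a) (l.map f) l := by
    rw [List.forall₂_map_left_iff]
    exact List.forall₂_same.2 fun _ _ => rfl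
  obtain ⟨k, hk1, hk2⟩ := List.perm_comp_forall₂ h.symm h1
  refine ⟨k, hk2.symm, ?_⟩
  have h2 : List.Forall₂ (· = ·) l' (k.map f) := List.forall₂_map_right_iff.2 hk1
  rw [List.forall₂_eq_eq_eq] at h2
  exact h2.symm

/-! ### Generalized eigenspaces and the factorization of powers -/

section Spectral

variable {n : ℕ} (A : Matrix (Fin n) (Fin n) ℂ)

/-- The matrix acting as multiplication by `f μ` on the generalized eigenspace of `A` for each
eigenvalue `μ`. -/
noncomputable def genEigenScaling (f : ℂ → ℂ) : Matrix (Fin n) (Fin n) ℂ :=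
  LinearMap.toMatrix' (∑ μ ∈ A.charpoly.roots.toFinset, f μ • genEigenProjection A μ)

theorem finrank_genEigenspace (μ : ℂ) :
    Module.finrank ℂ (genEigenspace A μ) = A.charpoly.roots.count μ := by
  rw [genEigenspace, LinearMap.finrank_maxGenEigenspace_eq, Matrix.charpoly_toLin',
    Polynomial.count_roots]

variable {A}

theorem genEigenScaling_mulVec (f : ℂ → ℂ) {μ : ℂ} {v : Fin n → ℂ} (hv : v ∈ genEigenspace A μ) :
    genEigenScaling A f *ᵥ v = f μ • v := by
  have hother : ∀ ν, ν ≠ μ → genEigenProjection A ν v = 0 := by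
    intro ν hν
    refine (Submodule.projection_apply_eq_zero_iff (isCompl_genEigenspace A ν)).2 ?_
    exact (le_iSup₂_of_le (f := fun κ (_ : κ ≠ ν) => genEigenspace A κ) μ hν.symm le_rfl) hv
  have hself : genEigenProjection A μ v = v :=
    Submodule.projection_apply_of_mem_left (isCompl_genEigenspace A μ) hv
  rw [genEigenScaling, LinearMap.toMatrix'_mulVec, LinearMap.sum_apply]
  by_cases hμ : μ ∈ A.charpoly.roots.toFinset
  · rw [Finset.sum_eq_single_of_mem μ hμ]
    · rw [LinearMap.smul_apply, hself]
    · intro ν _ hν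
      rw [LinearMap.smul_apply, hother ν hν, smul_zero]
  · have hbot : genEigenspace A μ = ⊥ := by
      rw [← Submodule.finrank_eq_zero (R := ℂ), finrank_genEigenspace]
      exact Multiset.count_eq_zero.2 fun h => hμ (Multiset.mem_toFinset.2 h)
    rw [hbot, Submodule.mem_bot] at hv
    simp [hv]

theorem ext_genEigenspace {S T : Matrix (Fin n) (Fin n) ℂ}
    (h : ∀ μ, ∀ v ∈ genEigenspace A μ, S *ᵥ v = T *ᵥ v) : S = T := by
  apply Matrix.toLin'.injective
  refine LinearMap.ext fun v => ?_
  have hv : v ∈ ⨆ μ, genEigenspace A μ := by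
    have := Module.End.iSup_maxGenEigenspace_eq_top (Matrix.toLin' A)
    exact this ▸ Submodule.mem_top
  induction hv using Submodule.iSup_induction' with
  | mem μ x hx => simpa using h μ x hx
  | zero => simp
  | add x y _ _ hx hy => rw [map_add, map_add, hx, hy]

theorem mulVec_mem_genEigenspace {S : Matrix (Fin n) (Fin n) ℂ} (hS : Commute A S) {μ : ℂ}
    {v : Fin n → ℂ} (hv : v ∈ genEigenspace A μ) : S *ᵥ v ∈ genEigenspace A μ := by
  have hc : Commute (Matrix.toLin' A) (Matrix.toLin' S) := by
    rw [Commute, SemiconjBy, Module.End.mul_eq_comp, Module.End.mul_eq_comp, ← Matrix.toLin'_mul,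
      ← Matrix.toLin'_mul, hS.eq]
  exact Module.End.mapsTo_maxGenEigenspace_of_comm hc μ hv

theorem commute_genEigenScaling (f : ℂ → ℂ) : Commute A (genEigenScaling A f) :=
  ext_genEigenspace (A := A) fun μ v hv => by
    rw [← Matrix.mulVec_mulVec, ← Matrix.mulVec_mulVec, genEigenScaling_mulVec f hv,
      genEigenScaling_mulVec f (mulVec_mem_genEigenspace (Commute.refl A) hv), Matrix.mulVec_smul]

theorem genEigenScaling_commute_of_commute {S : Matrix (Fin n) (Fin n) ℂ} (hS : Commute A S)
    (f : ℂ → ℂ) : Commute S (genEigenScaling A f) :=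
  ext_genEigenspace (A := A) fun μ v hv => by
    rw [← Matrix.mulVec_mulVec, ← Matrix.mulVec_mulVec, genEigenScaling_mulVec f hv,
      genEigenScaling_mulVec f (mulVec_mem_genEigenspace hS hv), Matrix.mulVec_smul]

/-- The `z`-eigenspace of `S` is nonzero and `A`-invariant, so `A` has an eigenvector in it. -/
theorem exists_common_eigenvector {S : Matrix (Fin n) (Fin n) ℂ} (hS : Commute A S) {z : ℂ}
    (hz : z ∈ spectrum ℂ S) : ∃ μ : ℂ, ∃ w ≠ 0, A *ᵥ w = μ • w ∧ S *ᵥ w = z • w := by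
  have hc : Commute (Matrix.toLin' S) (Matrix.toLin' A) := by
    rw [Commute, SemiconjBy, Module.End.mul_eq_comp, Module.End.mul_eq_comp, ← Matrix.toLin'_mul,
      ← Matrix.toLin'_mul, hS.eq]
  have hmaps : ∀ x ∈ Module.End.eigenspace (Matrix.toLin' S) z,
      Matrix.toLin' A x ∈ Module.End.eigenspace (Matrix.toLin' S) z :=
    Module.End.mapsTo_genEigenspace_of_comm hc z 1
  have hev : Module.End.HasEigenvalue (Matrix.toLin' S) z := by
    rwa [Module.End.hasEigenvalue_iff_mem_spectrum, Matrix.spectrum_toLin']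
  have : Nontrivial (Module.End.eigenspace (Matrix.toLin' S) z) :=
    Submodule.nontrivial_iff_ne_bot.2 hev
  obtain ⟨μ, hμ⟩ := Module.End.exists_eigenvalue ((Matrix.toLin' A).restrict hmaps)
  obtain ⟨w, hw⟩ := hμ.exists_hasEigenvector
  refine ⟨μ, w, fun h => hw.2 (Subtype.ext h), ?_, ?_⟩
  · have := congrArg Subtype.val hw.apply_eq_smul
    simpa using this
  · simpa using Module.End.mem_eigenspace_iff.1 w.2

theorem pow_mulVec_eq_zero {v : Fin n → ℂ} (hv : v ∈ genEigenspace A 0) {m : ℕ} (hm : n ≤ m) :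
    A ^ m *ᵥ v = 0 := by
  rw [genEigenspace, Module.End.maxGenEigenspace_eq_genEigenspace_finrank,
    Module.End.mem_genEigenspace_nat, zero_smul, sub_zero, LinearMap.mem_ker, ← Matrix.toLin'_pow,
    Matrix.toLin'_apply, Module.finrank_fin_fun] at hv
  rw [← Nat.sub_add_cancel hm, pow_add, ← Matrix.mulVec_mulVec, hv, Matrix.mulVec_zero]

variable (A) in
/-- The product of the elliptic and unipotent parts of `A`, extended by the identity on the
generalized eigenspace for `0`. -/
noncomputable def unimodularPart : Matrix (Fin n) (Fin n) ℂ :=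
  A * genEigenScaling A (fun μ => (‖μ‖ : ℂ)⁻¹) + genEigenScaling A fun μ => if μ = 0 then 1 else 0

variable (A) in
theorem commute_unimodularPart : Commute A (unimodularPart A) :=
  ((Commute.refl A).mul_right (commute_genEigenScaling _)).add_right (commute_genEigenScaling _)

theorem unimodularPart_mulVec {μ : ℂ} {v : Fin n → ℂ} (hv : v ∈ genEigenspace A μ) :
    unimodularPart A *ᵥ v = (‖μ‖ : ℂ)⁻¹ • A *ᵥ v + (if μ = 0 then (1 : ℂ) else 0) • v := by
  rw [unimodularPart, Matrix.add_mulVec, ← Matrix.mulVec_mulVec, genEigenScaling_mulVec _ hv,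
    genEigenScaling_mulVec _ hv, Matrix.mulVec_smul]

/-- On a common eigenvector with `A`-eigenvalue `μ`, the unimodular part acts by `μ / |μ|`, or by
`1` if `μ = 0`. -/
theorem norm_eq_one_of_mem_spectrum_unimodularPart {z : ℂ}
    (hz : z ∈ spectrum ℂ (unimodularPart A)) : ‖z‖ = 1 := by
  obtain ⟨μ, w, hw0, hw, hwz⟩ := exists_common_eigenvector (commute_unimodularPart A) hz
  have hmem : w ∈ genEigenspace A μ :=
    Module.End.eigenspace_le_maxGenEigenspace
      (Module.End.mem_eigenspace_iff.2 ((Matrix.toLin'_apply A w).trans hw))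
  rw [unimodularPart_mulVec hmem, hw, smul_smul, ← add_smul] at hwz
  rw [← smul_left_injective ℂ hw0 hwz]
  by_cases hμ : μ = 0
  · simp [hμ]
  · simp [hμ]

variable (A) in
theorem isUnit_unimodularPart : IsUnit (unimodularPart A) := by
  rw [← spectrum.zero_notMem_iff ℂ]
  intro h
  simpa using norm_eq_one_of_mem_spectrum_unimodularPart h

variable (A) in
-- Off the generalized kernel of `A` the product of the two factors is `A` itself; on that kernel
-- the product is `0`, and so is `A ^ m` once `m ≥ n`.
theorem pow_eq_hyperbolicElement_pow_mul {m : ℕ} (hm : n ≤ m) (hm0 : m ≠ 0) :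
    A ^ m = hyperbolicElement A ^ m * unimodularPart A ^ m := by
  -- `hyperbolicElement A` is by definition `genEigenScaling A` for the modulus function.
  have hc : Commute (hyperbolicElement A) (unimodularPart A) :=
    (genEigenScaling_commute_of_commute (commute_unimodularPart A) _).symm
  have hcA : Commute A (hyperbolicElement A * unimodularPart A) :=
    (commute_genEigenScaling _).mul_right (commute_unimodularPart A)
  rw [← hc.mul_pow]
  refine ext_genEigenspace (A := A) fun μ v hv => ?_
  have hone : ∀ x ∈ genEigenspace A μ,
      (hyperbolicElement A * unimodularPart A) *ᵥ x = if μ = 0 then 0 else A *ᵥ x := by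
    intro x hx
    rw [← Matrix.mulVec_mulVec, hyperbolicElement_mulVec A μ _
      (mulVec_mem_genEigenspace (commute_unimodularPart A) hx), unimodularPart_mulVec hx]
    by_cases hμ : μ = 0
    · simp [hμ]
    · simp [hμ, smul_smul]
  by_cases hμ : μ = 0
  · obtain ⟨k, rfl⟩ := Nat.exists_eq_succ_of_ne_zero hm0
    rw [pow_mulVec_eq_zero (hμ ▸ hv) hm, pow_succ, ← Matrix.mulVec_mulVec, hone v hv, if_pos hμ,
      Matrix.mulVec_zero]
  -- For `μ ≠ 0` the identity holds for every exponent, so the induction may start at `0`.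
  · clear hm hm0
    induction m with
    | zero => simp
    | succ k ih =>
      rw [pow_succ', pow_succ', ← Matrix.mulVec_mulVec, ih, ← Matrix.mulVec_mulVec,
        hone _ (mulVec_mem_genEigenspace (hcA.pow_right k) hv), if_neg hμ]

open scoped Matrix.Norms.L2Operator in
variable (A) in
theorem isSubexponential_norm_unimodularPart_pow :
    IsSubexponential (fun m => ‖unimodularPart A ^ m‖) ∧
      IsSubexponential (fun m => ‖(unimodularPart A)⁻¹ ^ m‖) := by
  refine ⟨isSubexponential_norm_pow _ fun z hz =>
    (norm_eq_one_of_mem_spectrum_unimodularPart hz).le, isSubexponential_norm_pow _ fun z hz => ?_⟩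
  obtain ⟨u, hu⟩ := isUnit_unimodularPart A
  rw [← hu, ← Matrix.coe_units_inv, ← spectrum.map_inv, Set.mem_inv, hu] at hz
  have := norm_eq_one_of_mem_spectrum_unimodularPart hz
  rw [norm_inv, inv_eq_one] at this
  exact this.le

variable (A) in
theorem antitone_eigenvalueModulus : Antitone (eigenvalueModulus A) := by
  intro i j hij
  have h := Multiset.pairwise_sort (A.charpoly.roots.map fun z : ℂ => ‖z‖) (· ≥ ·)
  rcases hij.eq_or_lt with rfl | hlt
  · exact le_rfl
  · exact List.pairwise_iff_get.1 h _ _ hlt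

variable (A) in
theorem exists_eigenvalue_enumeration : ∃ l : Fin n → ℂ,
    (∀ i, ‖l i‖ = eigenvalueModulus A i) ∧ Finset.univ.val.map l = A.charpoly.roots := by
  have hperm : (A.charpoly.roots.toList.map fun z : ℂ => ‖z‖).Perm (eigenvalueModuliList A) := by
    rw [← Multiset.coe_eq_coe, eigenvalueModuliList, Multiset.sort_eq, ← Multiset.map_coe,
      Multiset.coe_toList]
  obtain ⟨k, hk1, hk2⟩ := List.exists_perm_map_eq hperm
  have hlen : k.length = n := by
    rw [← length_eigenvalueModuliList A, ← hk2, List.length_map]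
  refine ⟨fun i => k.get (i.cast hlen.symm), fun i => ?_, ?_⟩
  · simp [eigenvalueModulus, ← hk2]
  · rw [Fin.univ_val_map, ← Multiset.coe_toList A.charpoly.roots, Multiset.coe_eq_coe]
    refine List.Perm.trans (List.Perm.of_eq ?_) hk1.symm
    subst hlen
    exact List.ofFn_get k

theorem eigenvalueModulus_nonneg (i : Fin n) : 0 ≤ eigenvalueModulus A i := by
  obtain ⟨l, hl, -⟩ := exists_eigenvalue_enumeration A
  exact hl i ▸ norm_nonneg _

variable (A) in
theorem exists_hyperbolicElement_eq : ∃ M : Matrix.GeneralLinearGroup (Fin n) ℂ,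
    hyperbolicElement A = M.val * moduliDiagonal A * (M⁻¹).val := by
  obtain ⟨l, hl, hroots⟩ := exists_eigenvalue_enumeration A
  have hint : DirectSum.IsInternal (genEigenspace A) :=
    (DirectSum.isInternal_submodule_iff_iSupIndep_and_iSup_eq_top _).2
      ⟨Module.End.independent_maxGenEigenspace _, Module.End.iSup_maxGenEigenspace_eq_top _⟩
  -- The dimension of each generalized eigenspace is the algebraic multiplicity, so its basis can be
  -- indexed by the positions of `μ` in the ordering `l`.
  have hfib : ∀ μ, Nonempty (Fin (Module.finrank ℂ (genEigenspace A μ)) ≃ {i // l i = μ}) := by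
    intro μ
    refine ⟨Fintype.equivOfCardEq ?_⟩
    rw [Fintype.card_fin, finrank_genEigenspace, ← hroots, Multiset.count_map, Fintype.card_subtype]
    simp [Finset.card_def, eq_comm]
  obtain ⟨σ, hσ⟩ : ∃ σ : (Σ μ, Fin (Module.finrank ℂ (genEigenspace A μ))) ≃ Fin n,
      ∀ x, l (σ x) = x.1 :=
    ⟨(Equiv.sigmaCongrRight fun μ => (hfib μ).some).trans (Equiv.sigmaFiberEquiv l),
      fun x => ((hfib x.1).some x.2).2⟩
  obtain ⟨b, hb⟩ : ∃ b : Module.Basis (Fin n) ℂ (Fin n → ℂ), ∀ i, b i ∈ genEigenspace A (l i) := by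
    refine ⟨(hint.collectedBasis fun μ => Module.finBasis ℂ (genEigenspace A μ)).reindex σ,
      fun i => ?_⟩
    obtain ⟨x, rfl⟩ := σ.surjective i
    rw [hσ, Module.Basis.reindex_apply, Equiv.symm_apply_apply]
    exact hint.collectedBasis_mem _ _
  let e := Pi.basisFun ℂ (Fin n)
  let M : Matrix.GeneralLinearGroup (Fin n) ℂ :=
    ⟨e.toMatrix b, b.toMatrix e, e.toMatrix_mul_toMatrix_flip b, b.toMatrix_mul_toMatrix_flip e⟩
  have hM : ∀ i, M.val *ᵥ Pi.single i 1 = b i := fun i => by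
    rw [Matrix.mulVec_single_one]
    ext j
    simp [M, e, Module.Basis.toMatrix_apply]
  refine ⟨M, ?_⟩
  have hHM : hyperbolicElement A * M.val = M.val * moduliDiagonal A := by
    refine Matrix.ext_of_mulVec_single fun k => ?_
    rw [← Matrix.mulVec_mulVec, ← Matrix.mulVec_mulVec, hM, hyperbolicElement_mulVec A _ _ (hb k),
      moduliDiagonal, Matrix.diagonal_mulVec_single, mul_one, hl, ← hM k, ← Matrix.mulVec_smul,
      ← Pi.single_smul, smul_eq_mul, mul_one]
  rw [← hHM, mul_assoc, M.mul_inv, mul_one]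

end Spectral

/-! ### Assembling the limit -/

theorem conj_pow_of_mul_eq_one {G : Type*} [Monoid G] {q q' : G} (h : q' * q = 1) (h' : q * q' = 1)
    (d : G) (m : ℕ) : (q * d * q') ^ m = q * d ^ m * q' :=
  Units.conj_pow ⟨q, q', h', h⟩ d m

section Limit

open scoped Matrix.Norms.L2Operator

variable {n : ℕ}

theorem isSubexponential_norm_mul {f g : ℕ → Matrix (Fin n) (Fin n) ℂ}
    (hf : IsSubexponential fun m => ‖f m‖) (hg : IsSubexponential fun m => ‖g m‖) :
    IsSubexponential fun m => ‖f m * g m‖ :=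
  (hf.mul hg fun _ => norm_nonneg _).mono (Eventually.of_forall fun _ => norm_mul_le _ _)

theorem tendsto_leftAbs_rpow_one_div {E : Matrix (Fin n) (Fin n) ℂ} (hE : 0 ≤ E)
    (x y z : ℕ → Matrix (Fin n) (Fin n) ℂ) (hx : ∀ᶠ m in atTop, x m = E ^ m * y m)
    (hyz : ∀ m, y m * z m = 1) (hy : IsSubexponential fun m => ‖y m‖)
    (hz : IsSubexponential fun m => ‖z m‖) :
    Tendsto (fun m : ℕ => CFC.rpow (leftAbs (x m)) (1 / (m : ℝ))) atTop (𝓝 E) := by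
  refine (tendsto_abs_rpow_one_div hE y z hyz hy hz).congr' ?_
  filter_upwards [hx] with m hm
  rw [hm]
  rfl

theorem tendsto_leftAbs_of_unitary_mul_upperTriangular (A : Matrix (Fin n) (Fin n) ℂ)
    (B C M : Matrix.GeneralLinearGroup (Fin n) ℂ) {Q R : Matrix (Fin n) (Fin n) ℂ}
    (hM : hyperbolicElement A = M.val * moduliDiagonal A * (M⁻¹).val)
    (hQ : Q ∈ Matrix.unitaryGroup (Fin n) ℂ) (hR : R.IsUpperTriangular)
    (hQR : B.val * M.val = Q * R) :
    Tendsto (fun m : ℕ => CFC.rpow (leftAbs (B.val * A ^ m * C.val)) (1 / (m : ℝ))) atTop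
      (𝓝 (Q * moduliDiagonal A * Qᴴ)) := by
  have hQ1 : Qᴴ * Q = 1 := Matrix.mem_unitaryGroup_iff'.1 hQ
  have hQ2 : Q * Qᴴ = 1 := Matrix.mem_unitaryGroup_iff.1 hQ
  have hRdet : IsUnit R.det := by
    have hRQ : R = Qᴴ * (B.val * M.val) := by rw [hQR, ← mul_assoc, hQ1, one_mul]
    rw [← Matrix.isUnit_iff_isUnit_det, hRQ]
    exact (IsUnit.of_mul_eq_one _ hQ1).mul (B.isUnit.mul M.isUnit)
  have hN := isUnit_unimodularPart A
  obtain ⟨hNs, hNs'⟩ := isSubexponential_norm_unimodularPart_pow A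
  obtain ⟨S, T, hST, hS, hSs, hTs⟩ := Matrix.exists_mul_diagonal_pow_eq
    (antitone_eigenvalueModulus A) eigenvalueModulus_nonneg hR hRdet
  change ∀ m, R * moduliDiagonal A ^ m = moduliDiagonal A ^ m * S m at hS
  have hD : 0 ≤ Q * moduliDiagonal A * Qᴴ := by
    rw [Matrix.nonneg_iff_posSemidef]
    refine Matrix.PosSemidef.mul_mul_conjTranspose_same ?_ Q
    exact Matrix.PosSemidef.diagonal fun i => by
      simpa using eigenvalueModulus_nonneg (A := A) i
  have hNpow : ∀ m, unimodularPart A ^ m * (unimodularPart A)⁻¹ ^ m = 1 := fun m => by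
    obtain ⟨u, hu⟩ := hN
    rw [← hu, ← Matrix.coe_units_inv, ← Units.val_pow_eq_pow_val, ← Units.val_pow_eq_pow_val,
      inv_pow, Units.mul_inv]
  have hconst : ∀ K : Matrix (Fin n) (Fin n) ℂ, IsSubexponential fun _ => ‖K‖ :=
    fun K => isSubexponential_const _
  refine tendsto_leftAbs_rpow_one_div hD _
    (fun m => Q * (S m * ((M⁻¹).val * (unimodularPart A ^ m * C.val))))
    (fun m => (C⁻¹).val * ((unimodularPart A)⁻¹ ^ m * (M.val * (T m * Qᴴ)))) ?_ (fun m => ?_) ?_ ?_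
  · filter_upwards [eventually_ge_atTop n, eventually_ne_atTop 0] with m hm hm0
    rw [conj_pow_of_mul_eq_one hQ1 hQ2, pow_eq_hyperbolicElement_pow_mul A hm hm0, hM,
      conj_pow_of_mul_eq_one M.inv_mul M.mul_inv]
    calc _ = B.val * M.val * moduliDiagonal A ^ m *
          ((M⁻¹).val * (unimodularPart A ^ m * C.val)) := by simp only [mul_assoc]
      _ = Q * (moduliDiagonal A ^ m * S m) * ((M⁻¹).val * (unimodularPart A ^ m * C.val)) := by
        rw [hQR, mul_assoc Q, hS]
      _ = Q * moduliDiagonal A ^ m * (Qᴴ * Q) *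
          (S m * ((M⁻¹).val * (unimodularPart A ^ m * C.val))) := by
        rw [hQ1, mul_one]
        simp only [mul_assoc]
      _ = _ := by simp only [mul_assoc]
  · calc _ = Q * (S m * ((M⁻¹).val * (unimodularPart A ^ m * (C.val * (C⁻¹).val) *
          (unimodularPart A)⁻¹ ^ m * M.val)) * T m) * Qᴴ := by simp only [mul_assoc]
      _ = 1 := by
        rw [C.mul_inv, mul_one, hNpow, one_mul, M.inv_mul, mul_one, hST, mul_one, hQ2]
  · exact isSubexponential_norm_mul (hconst _) (isSubexponential_norm_mul hSs
      (isSubexponential_norm_mul (hconst _) (isSubexponential_norm_mul hNs (hconst _))))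
  · exact isSubexponential_norm_mul (hconst _) (isSubexponential_norm_mul hNs'
      (isSubexponential_norm_mul (hconst _) (isSubexponential_norm_mul hTs (hconst _))))

end Limit

theorem mainTheorem2 {n : ℕ} (A : Matrix (Fin n) (Fin n) ℂ)
    (B : Matrix.GeneralLinearGroup (Fin n) ℂ) :
    ∃ X : Matrix (Fin n) (Fin n) ℂ,
      (∀ C : Matrix.GeneralLinearGroup (Fin n) ℂ,
        Filter.Tendsto
          (fun m : ℕ => CFC.rpow (leftAbs (B.val * A ^ m * C.val)) (1 / (m : ℝ)))
          Filter.atTop (𝓝 X)) ∧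
      (∀ (M : Matrix.GeneralLinearGroup (Fin n) ℂ) (Q R : Matrix (Fin n) (Fin n) ℂ),
        hyperbolicElement A = M.val * moduliDiagonal A * (M⁻¹).val →
        Q ∈ Matrix.unitaryGroup (Fin n) ℂ →
        R.IsUpperTriangular →
        B.val * M.val = Q * R →
        X = Q * moduliDiagonal A * Qᴴ) := by
  obtain ⟨M, hM⟩ := exists_hyperbolicElement_eq A
  obtain ⟨Q, R, hQ, hR, hQR⟩ := Matrix.exists_unitary_mul_isUpperTriangular (B.val * M.val)
  have hlim := fun C => tendsto_leftAbs_of_unitary_mul_upperTriangular A B C M hM hQ hR hQR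
  refine ⟨Q * moduliDiagonal A * Qᴴ, hlim, fun M' Q' R' hM' hQ' hR' hQR' => ?_⟩
  -- Any one `C` suffices to compare the two limits; take `C = 1`.
  exact tendsto_nhds_unique (hlim 1)
    (tendsto_leftAbs_of_unitary_mul_upperTriangular A B 1 M' hM' hQ' hR' hQR')
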